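/- Let $(V,E,F)$ be a (finite) cell decomposition of an oriented topological torus $S$, whose fundamental group is generated by (the classes of) two closed edge paths $\gamma_1,\gamma_2$ with a common base vertex, and let $c:E\to\mathbb{R}_{>0}$ be positive edge weights. For $\tau$ in the upper half plane $\mathbb{H}$ let $S_\tau$ be the Euclidean torus of unit area obtained as the quotient of $\mathbb{C}$ by the translations by $1/\sqrt{\operatorname{Im}\tau}$ and $\tau/\sqrt{\operatorname{Im}\tau}$, marked by letting these correspond to $\gamma_1$ and $\gamma_2$. Consider all pairs $(\tau,h)$, where $\tau\in\mathbb{H}$ and $h:(V,E)\to S_\tau$ is a map of the graph, straight on edges, in the homotopy class determined by the marking, i.e. $h$ has a lift $\tilde h$ to the universal cover with $\tilde h\circ\gamma_1=\tilde h+1/\sqrt{\operatorname{Im}\tau}$ and $\tilde h\circ\gamma_2=\tilde h+\tau/\sqrt{\operatorname{Im}\tau}$. The Dirichlet energy of such a pair is $\mathcal{E}_c(\tau,h)=\frac12\sum_{e\in E}c_e\,\ell_e^2$, where $\ell_e$ is the length of the image of the edge $e$ under $h$. Then $\mathcal{E}_c$ attains its minimum over all such pairs, and the minimum is $$k_c:=\min\mathcal{E}_c=\sqrt{\frac{\det_0(\tilde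 d^{T}C\tilde d)}{\det_0(d^{T}Cd)}}.$$ Here an orientation of each edge is fixed; $d$ is the $E\times V$ incidence matrix, $(df)(e)=f(e_+)-f(e_-)$ with $e_+$ the head and $e_-$ the tail of $e$; $C$ is the diagonal matrix of the edge weights; $\tilde d$ is the $E\times(V+2)$ matrix obtained from $d$ by adding two columns $m_1,m_2$, which are any closed discrete 1-forms (the sum over the boundary of every face is zero) with periods $\sum_{\gamma_1}m_1=1$, $\sum_{\gamma_2}m_1=0$ and $\sum_{\gamma_1}m_2=0$, $\sum_{\gamma_2}m_2=1$; and $\det_0$ is the product of the nonzero eigenvalues, counted with multiplicity (the empty product being $1$). -/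

import Mathlib

open scoped UpperHalfPlane

noncomputable section

/-- An oriented edge: `(e, true)` is the edge `e` with its fixed orientation, `(e, false)` is the
same edge traversed backwards. -/
abbrev Dart (E : Type*) := E × Bool

/-- The same edge with the opposite orientation. -/
def Dart.rev {E : Type*} (a : Dart E) : Dart E := (a.1, !a.2)

/-- A cell decomposition of a connected closed oriented surface with vertices `V`, edges `E` and
faces `F`, given as a combinatorial map. Loops and multiple edges are allowed.
`src a` is the initial vertex of the oriented edge `a`, `left a` is the face on its left and
`next a` is the oriented edge that follows `a` on the boundary of that face, so that the faces are
the cycles of `next`; the vertices are the cycles of the rotation `a ↦ next (rev a)`, which runs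
through the oriented edges that start at a vertex in their cyclic order. -/
structure CellDecomposition (V E F : Type*) where
  src : Dart E → V
  left : Dart E → F
  next : Equiv.Perm (Dart E)
  rot : Equiv.Perm (Dart E)
  rot_apply : ∀ a, rot a = next a.rev
  src_surjective : Function.Surjective src
  left_surjective : Function.Surjective left
  src_eq_iff : ∀ a b, src a = src b ↔ rot.SameCycle a b
  left_eq_iff : ∀ a b, left a = left b ↔ next.SameCycle a b
  nonempty : Nonempty V
  connected : ∀ u v, Relation.ReflTransGen (fun x y => ∃ a : Dart E, src a = x ∧ src a.rev = y) u v

namespace CellDecomposition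

variable {V E F : Type*}

/-- The terminal vertex of an oriented edge. -/
def tgt (G : CellDecomposition V E F) (a : Dart E) : V := G.src a.rev

/-- The tail of an edge with its fixed orientation. -/
def tail (G : CellDecomposition V E F) (e : E) : V := G.src (e, true)

/-- The head of an edge with its fixed orientation. -/
def head (G : CellDecomposition V E F) (e : E) : V := G.tgt (e, true)

/-- The surface is a torus: its Euler characteristic `|V| - |E| + |F|` is zero. -/
def IsTorus [Fintype V] [Fintype E] [Fintype F] (_G : CellDecomposition V E F) : Prop :=
  Fintype.card V + Fintype.card F = Fintype.card E

/-- The boundary of the face on the left of `a`, as a list of oriented edges starting with `a`. -/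
def faceBoundary (G : CellDecomposition V E F) (a : Dart E) : List (Dart E) :=
  List.iterate G.next a (Function.minimalPeriod G.next a)

/-! ### Edge paths and their homotopy classes -/

/-- The list `p` of oriented edges is an edge path from `u` to `v`. -/
def IsWalk (G : CellDecomposition V E F) : V → List (Dart E) → V → Prop
  | u, [], v => u = v
  | u, a :: p, v => G.src a = u ∧ IsWalk G (G.tgt a) p v

theorem IsWalk.append {G : CellDecomposition V E F} {v w : V} {q : List (Dart E)} :
    ∀ {p : List (Dart E)} {u : V}, G.IsWalk u p v → G.IsWalk v q w → G.IsWalk u (p ++ q) w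
  | [], _, hp, hq => by
    have h : _ = v := hp
    subst h
    exact hq
  | _ :: _, _, hp, hq => ⟨hp.1, IsWalk.append hp.2 hq⟩

/-- Edge paths from `u` to `v`. -/
def Walk (G : CellDecomposition V E F) (u v : V) := {p : List (Dart E) // G.IsWalk u p v}

/-- Concatenation of edge paths. -/
def Walk.append {G : CellDecomposition V E F} {u v w : V} (p : G.Walk u v) (q : G.Walk v w) :
    G.Walk u w := ⟨p.1 ++ q.1, p.2.append q.2⟩

/-- The edge path consisting of a single oriented edge. -/
def dartWalk (G : CellDecomposition V E F) (a : Dart E) : G.Walk (G.src a) (G.tgt a) :=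
  ⟨[a], rfl, rfl⟩

/-- An elementary homotopy of edge paths with fixed end points: `q` arises from `p` by inserting an
edge followed by its reverse, or by inserting the boundary of a face. -/
def HomotopyStep (G : CellDecomposition V E F) {u v : V} (p q : G.Walk u v) : Prop :=
  ∃ (x y : List (Dart E)) (a : Dart E), p.1 = x ++ y ∧
    (q.1 = x ++ [a, a.rev] ++ y ∨ q.1 = x ++ G.faceBoundary a ++ y)

/-- Homotopy classes of edge paths from `u` to `v` in the surface: two edge paths are homotopic when
they are joined by finitely many elementary homotopies and their inverses. -/
def PathClass (G : CellDecomposition V E F) (u v : V) := Quot (G.HomotopyStep (u := u) (v := v))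

/-- The homotopy class of an edge path. -/
def Walk.cls {G : CellDecomposition V E F} {u v : V} (p : G.Walk u v) : G.PathClass u v :=
  Quot.mk _ p

theorem HomotopyStep.append_left {G : CellDecomposition V E F} {u v w : V} (p : G.Walk u v)
    {q r : G.Walk v w} (h : G.HomotopyStep q r) : G.HomotopyStep (p.append q) (p.append r) := by
  obtain ⟨x, y, a, hq, hr⟩ := h
  refine ⟨p.1 ++ x, y, a, by simp [Walk.append, hq], ?_⟩
  rcases hr with hr | hr
  · exact Or.inl (by simp [Walk.append, hr])
  · exact Or.inr (by simp [Walk.append, hr])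

theorem HomotopyStep.append_right {G : CellDecomposition V E F} {u v w : V} (p : G.Walk v w)
    {q r : G.Walk u v} (h : G.HomotopyStep q r) : G.HomotopyStep (q.append p) (r.append p) := by
  obtain ⟨x, y, a, hq, hr⟩ := h
  refine ⟨x, y ++ p.1, a, by simp [Walk.append, hq], ?_⟩
  rcases hr with hr | hr
  · exact Or.inl (by simp [Walk.append, hr])
  · exact Or.inr (by simp [Walk.append, hr])

/-- The closed edge paths `γ 0`, `γ 1` based at `o` generate the fundamental group of the surface:
every closed edge path based at `o` is homotopic to a concatenation of copies of `γ 0`, `γ 1` and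
their reverses. -/
def Generates (G : CellDecomposition V E F) {o : V} (γ : Fin 2 → G.Walk o o) : Prop :=
  ∀ p : G.Walk o o, ∃ (l : List (List (Dart E))) (hl : G.IsWalk o l.flatten o),
    (∀ q ∈ l, ∃ k, q = (γ k).1 ∨ q = ((γ k).1.map Dart.rev).reverse) ∧
    p.cls = Walk.cls (⟨l.flatten, hl⟩ : G.Walk o o)

/-! ### The universal cover -/

/-- The vertices of the universal cover: a vertex `v` together with the homotopy class of an edge
path from the base point `o` to `v`. -/
def CoverVertex (G : CellDecomposition V E F) (o : V) := Σ v : V, G.PathClass o v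

/-- The terminal vertex of the lift of `a` that starts at the given lift of `src a`. -/
def PathClass.extend {G : CellDecomposition V E F} {o : V} (a : Dart E)
    (x : G.PathClass o (G.src a)) : G.PathClass o (G.tgt a) :=
  Quot.map (fun p => p.append (G.dartWalk a)) (fun _ _ h => h.append_right (G.dartWalk a)) x

/-- The deck transformation of the universal cover given by a closed edge path at the base point. -/
def deck {G : CellDecomposition V E F} {o : V} (γ : G.Walk o o) (x : G.CoverVertex o) :
    G.CoverVertex o :=
  ⟨x.1, Quot.map (fun p => γ.append p) (fun _ _ h => h.append_left γ) x.2⟩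

/-! ### Discrete 1-forms -/

/-- The value on an oriented edge of the discrete 1-form given by its values on the edges with their
fixed orientation. -/
def dartValue (ω : E → ℝ) (a : Dart E) : ℝ := if a.2 then ω a.1 else -ω a.1

/-- The sum of a discrete 1-form along a list of oriented edges. -/
def integral (ω : E → ℝ) (p : List (Dart E)) : ℝ := (p.map (dartValue ω)).sum

/-- A discrete 1-form is closed if its sum over the boundary of every face is zero. -/
def IsClosedForm (G : CellDecomposition V E F) (ω : E → ℝ) : Prop :=
  ∀ a : Dart E, integral ω (G.faceBoundary a) = 0

/-- The incidence matrix, `(d f) e = f (head e) - f (tail e)`. -/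
def incidence [DecidableEq V] (G : CellDecomposition V E F) : Matrix E V ℝ :=
  Matrix.of fun e v => (if G.head e = v then 1 else 0) - (if G.tail e = v then 1 else 0)

/-- The incidence matrix with the two 1-forms `m 0`, `m 1` as additional columns. -/
def augmented [DecidableEq V] (G : CellDecomposition V E F) (m : Fin 2 → E → ℝ) :
    Matrix E (V ⊕ Fin 2) ℝ :=
  Matrix.fromCols G.incidence (Matrix.of fun e k => m k e)

end CellDecomposition

/-- The product of the nonzero eigenvalues, with multiplicity, of a real symmetric matrix. -/
def det₀ {n : Type*} [Fintype n] [DecidableEq n] (A : Matrix n n ℝ) : ℝ :=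
  open Classical in (A.charpoly.roots.filter fun x => x ≠ 0).prod

/-! ### Euclidean tori of unit area and their straight-line maps -/

/-- The translation vectors `1 / √(Im τ)` and `τ / √(Im τ)` of the two generators. -/
def torusPeriod (τ : ℍ) : Fin 2 → ℂ :=
  ![1 / (Real.sqrt τ.im : ℂ), (τ : ℂ) / (Real.sqrt τ.im : ℂ)]

/-- The lattice of the Euclidean torus with parameter `τ`. -/
def torusLattice (τ : ℍ) : AddSubgroup ℂ := AddSubgroup.closure (Set.range (torusPeriod τ))

/-- The Euclidean torus of unit area with parameter `τ`. -/
abbrev EuclideanTorus (τ : ℍ) := ℂ ⧸ torusLattice τ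

/-- A map of the graph to the Euclidean torus that is straight on the edges: the edge `e` is mapped
to the projection of a segment with displacement `vec e`, that is, to the curve
`t ↦ pos (tail e) + t • vec e`, which has to end at `pos (head e)`. -/
structure StraightLineMap {V E F : Type*} (G : CellDecomposition V E F) (τ : ℍ) where
  pos : V → EuclideanTorus τ
  vec : E → ℂ
  pos_head : ∀ e, pos (G.head e) = pos (G.tail e) + (vec e : EuclideanTorus τ)

namespace StraightLineMap

variable {V E F : Type*} {G : CellDecomposition V E F} {τ : ℍ}

/-- The length of the image of an edge. -/
def edgeLength (h : StraightLineMap G τ) (e : E) : ℝ := ‖h.vec e‖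

/-- The Dirichlet energy. -/
def energy [Fintype E] (c : E → ℝ) (h : StraightLineMap G τ) : ℝ :=
  1 / 2 * ∑ e, c e * h.edgeLength e ^ 2

/-- `ht` is a lift of `h` to the universal covers: it covers `h` on the vertices, and it maps every
lift of an edge to the corresponding lift of the straight image of that edge. -/
def IsLift {o : V} (h : StraightLineMap G τ) (ht : G.CoverVertex o → ℂ) : Prop :=
  (∀ x, (ht x : EuclideanTorus τ) = h.pos x.1) ∧
  ∀ (e : E) (x : G.PathClass o (G.tail e)),
    ht ⟨G.head e, x.extend (e, true)⟩ - ht ⟨G.tail e, x⟩ = h.vec e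

/-- `h` lies in the homotopy class of the given realization of the graph in the marked torus: it
lifts to the universal covers in such a way that the deck transformations of the generators
`γ 0`, `γ 1` correspond to the translations by `1 / √(Im τ)` and `τ / √(Im τ)`. -/
def InHomotopyClass {o : V} (γ : Fin 2 → G.Walk o o) (h : StraightLineMap G τ) : Prop :=
  ∃ ht : G.CoverVertex o → ℂ, h.IsLift ht ∧
    ∀ k x, ht (CellDecomposition.deck (γ k) x) = ht x + torusPeriod τ k

end StraightLineMap

end

/-! A lift to the universal cover shows that the real and imaginary parts of the edge vectors are
closed 1-forms whose periods are those of the torus (`closed_and_periods`). Conversely, closed forms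
with dual integral periods yield a map to every torus (`exists_of_closed_forms`). For fixed `τ` the
energy is least when both parts are harmonic, that is, `c`-orthogonal to all gradients, because
closed forms with equal periods differ by a gradient (`Generates.exists_grad`,
`sum_mul_sq_ge_of_periods`).

Let `p`, `q`, `r` be the entries of the Gram matrix of the harmonic forms `ω 0`, `ω 1` dual to the
generators. The least energy at `τ = x + iy` is `(p + 2qx + r(x² + y²)) / (2y)`; completing squares
bounds it below by `√(pr - q²)`, with equality at one `τ`.

It remains to identify `pr - q²` with the quotient of the `det₀`. Both matrices have a line as
kernel, and adding the projection to it turns `det₀` into `det`. The Schur complement of the block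
of `d` is then the Gram matrix of the harmonic representatives of `m 0`, `m 1`
(`exists_det₀_fromCols_eq`). -/

namespace CellDecomposition

variable {V E F : Type*}

/-! ### Integrals of discrete 1-forms along edge paths -/

theorem integral_nil (ω : E → ℝ) : integral ω [] = 0 := rfl

theorem integral_zero (p : List (Dart E)) : integral (fun _ => 0) p = 0 :=
  List.sum_eq_zero fun x hx => by
    obtain ⟨a, -, rfl⟩ := List.mem_map.1 hx
    simp [dartValue]

theorem integral_cons (ω : E → ℝ) (a : Dart E) (p : List (Dart E)) :
    integral ω (a :: p) = dartValue ω a + integral ω p := by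
  simp [integral]

theorem integral_append (ω : E → ℝ) (p q : List (Dart E)) :
    integral ω (p ++ q) = integral ω p + integral ω q := by
  simp [integral]

theorem dartValue_rev (ω : E → ℝ) (a : Dart E) : dartValue ω a.rev = -dartValue ω a := by
  rcases a with ⟨e, _ | _⟩ <;> simp [dartValue, Dart.rev]

theorem rev_rev (a : Dart E) : a.rev.rev = a := by
  rcases a with ⟨e, b⟩; simp [Dart.rev]

theorem integral_map_rev_reverse (ω : E → ℝ) (p : List (Dart E)) :
    integral ω (p.map Dart.rev).reverse = -integral ω p := by
  induction p with
  | nil => simp [integral]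
  | cons a p ih =>
    rw [List.map_cons, List.reverse_cons, integral_append, ih, integral_cons, integral_cons,
      integral_nil, dartValue_rev]
    ring

theorem integral_sub_smul (ω η : E → ℝ) (t : ℝ) (p : List (Dart E)) :
    integral (fun e => ω e - t * η e) p = integral ω p - t * integral η p := by
  induction p with
  | nil => simp [integral]
  | cons a p ih =>
    rw [integral_cons, integral_cons, integral_cons, ih]
    rcases a with ⟨e, _ | _⟩ <;> simp [dartValue] <;> ring

variable (G : CellDecomposition V E F)

theorem IsClosedForm.sub_smul {G : CellDecomposition V E F} {ω η : E → ℝ} (hω : G.IsClosedForm ω)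
    (hη : G.IsClosedForm η) (t : ℝ) : G.IsClosedForm (fun e => ω e - t * η e) := fun a => by
  rw [integral_sub_smul, hω a, hη a]; simp

theorem integral_grad (f : V → ℝ) {p : List (Dart E)} {u v : V} (hp : G.IsWalk u p v) :
    integral (fun e => f (G.head e) - f (G.tail e)) p = f v - f u := by
  induction p generalizing u with
  | nil => obtain rfl : u = v := hp; simp [integral]
  | cons a p ih =>
    obtain ⟨rfl, hq⟩ := hp
    rw [integral_cons, ih hq]
    rcases a with ⟨e, _ | _⟩ <;> simp [dartValue, tail, head, tgt, Dart.rev]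

theorem src_next (a : Dart E) : G.src (G.next a) = G.tgt a := by
  have h : G.next a = G.rot a.rev := by rw [G.rot_apply, rev_rev]
  rw [h]
  exact (G.src_eq_iff _ _).2 (Equiv.Perm.sameCycle_apply_left.2 (Equiv.Perm.SameCycle.refl _ _))

theorem isWalk_iterate_next (n : ℕ) (a : Dart E) :
    G.IsWalk (G.src a) (List.iterate G.next a n) (G.src (G.next^[n] a)) := by
  induction n generalizing a with
  | zero => rfl
  | succ n ih =>
    refine ⟨rfl, ?_⟩
    rw [← G.src_next]
    exact ih (G.next a)

theorem isWalk_faceBoundary (a : Dart E) : G.IsWalk (G.src a) (G.faceBoundary a) (G.src a) := by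
  have h := G.isWalk_iterate_next (Function.minimalPeriod G.next a) a
  rwa [Function.iterate_minimalPeriod] at h

theorem isClosedForm_grad (f : V → ℝ) :
    G.IsClosedForm (fun e => f (G.head e) - f (G.tail e)) := fun a => by
  rw [G.integral_grad f (G.isWalk_faceBoundary a), sub_self]

theorem isWalk_map_rev_reverse {p : List (Dart E)} {u v : V} (hp : G.IsWalk u p v) :
    G.IsWalk v (p.map Dart.rev).reverse u := by
  induction p generalizing u with
  | nil => exact Eq.symm hp
  | cons a p ih =>
    obtain ⟨rfl, hq⟩ := hp
    rw [List.map_cons, List.reverse_cons]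
    refine (ih hq).append ⟨rfl, ?_⟩
    simp only [IsWalk, tgt, rev_rev]

theorem exists_walk (u v : V) : Nonempty (G.Walk u v) := by
  induction G.connected u v with
  | refl => exact ⟨⟨[], rfl⟩⟩
  | tail _ h ih =>
    obtain ⟨p⟩ := ih
    obtain ⟨a, rfl, rfl⟩ := h
    exact ⟨p.append (G.dartWalk a)⟩

/-! ### Homotopy invariance, periods and exactness -/

variable {G}

theorem IsClosedForm.integral_eq_of_homotopyStep {ω : E → ℝ} (hω : G.IsClosedForm ω) {u v : V}
    {p q : G.Walk u v} (h : G.HomotopyStep p q) : integral ω p.1 = integral ω q.1 := by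
  obtain ⟨x, y, a, hp, hq | hq⟩ := h
  · rw [hp, hq]
    simp only [integral_append, integral_cons, integral_nil, dartValue_rev]
    ring
  · rw [hp, hq]
    simp only [integral_append, hω a]
    ring

/-- The integral of a closed form over a homotopy class of edge paths. -/
def IsClosedForm.classIntegral {ω : E → ℝ} (hω : G.IsClosedForm ω) {u v : V} :
    G.PathClass u v → ℝ :=
  Quot.lift (fun p => integral ω p.1) fun _ _ => hω.integral_eq_of_homotopyStep

theorem IsClosedForm.integral_eq_of_cls_eq {ω : E → ℝ} (hω : G.IsClosedForm ω) {u v : V}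
    {p q : G.Walk u v} (h : p.cls = q.cls) : integral ω p.1 = integral ω q.1 :=
  congrArg hω.classIntegral h

/-- The subgroup is a parameter so that one induction serves two purposes: `⊥` gives exactness, and
the integers give well-definedness modulo the lattice. -/
theorem Generates.integral_mem {o : V} {γ : Fin 2 → G.Walk o o} (hγ : G.Generates γ) {ω : E → ℝ}
    (hω : G.IsClosedForm ω) (A : AddSubgroup ℝ) (hA : ∀ k, integral ω (γ k).1 ∈ A)
    {p : List (Dart E)} (hp : G.IsWalk o p o) : integral ω p ∈ A := by
  obtain ⟨l, hl, hmem, hcls⟩ := hγ ⟨p, hp⟩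
  have h : integral ω p = integral ω l.flatten := hω.integral_eq_of_cls_eq hcls
  rw [h]
  clear h hcls hl
  induction l with
  | nil => simp [integral]
  | cons q l ih =>
    rw [List.flatten_cons, integral_append]
    refine A.add_mem ?_ (ih fun r hr => hmem r (List.mem_cons_of_mem _ hr))
    obtain ⟨k, rfl | rfl⟩ := hmem q List.mem_cons_self
    · exact hA k
    · rw [integral_map_rev_reverse]
      exact A.neg_mem (hA k)

/-- Integrals along two edge paths from `o` to `v` differ by a period. -/
theorem Generates.integral_sub_mem {o : V} {γ : Fin 2 → G.Walk o o} (hγ : G.Generates γ)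
    {ω : E → ℝ} (hω : G.IsClosedForm ω) (A : AddSubgroup ℝ) (hA : ∀ k, integral ω (γ k).1 ∈ A)
    {v : V} {p q : List (Dart E)} (hp : G.IsWalk o p v) (hq : G.IsWalk o q v) :
    integral ω p - integral ω q ∈ A := by
  have h := hγ.integral_mem hω A hA (hp.append (G.isWalk_map_rev_reverse hq))
  rwa [integral_append, integral_map_rev_reverse, ← sub_eq_add_neg] at h

/-- A closed form with vanishing periods is exact. -/
theorem Generates.exists_grad {o : V} {γ : Fin 2 → G.Walk o o} (hγ : G.Generates γ) {ω : E → ℝ}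
    (hω : G.IsClosedForm ω) (h0 : ∀ k, integral ω (γ k).1 = 0) :
    ∃ f : V → ℝ, ∀ e, ω e = f (G.head e) - f (G.tail e) := by
  let w : ∀ v, G.Walk o v := fun v => (G.exists_walk o v).some
  refine ⟨fun v => integral ω (w v).1, fun e => ?_⟩
  have h := hγ.integral_sub_mem hω ⊥ (fun k => by simp [h0 k]) (w (G.head e)).2
    ((w (G.tail e)).append (G.dartWalk (e, true))).2
  rw [AddSubgroup.mem_bot] at h
  simp only [Walk.append, dartWalk, integral_append, integral_cons, integral_nil, dartValue,
    if_true] at h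
  linarith

/-! ### Functions on the universal cover -/

/-- A function on the vertices of the universal cover whose differences along lifted edges are
given by `ω` integrates `ω` along edge paths. -/
theorem integral_eq_of_lift {o : V} {ω : E → ℝ} {g : G.CoverVertex o → ℝ}
    (hg : ∀ (e : E) (x : G.PathClass o (G.tail e)),
      g ⟨G.head e, x.extend (e, true)⟩ - g ⟨G.tail e, x⟩ = ω e)
    {u v : V} (p : G.Walk o u) (q : G.Walk u v) :
    integral ω q.1 = g ⟨v, (p.append q).cls⟩ - g ⟨u, p.cls⟩ := by
  have hdart : ∀ (a : Dart E) (p : G.Walk o (G.src a)),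
      dartValue ω a = g ⟨G.tgt a, (p.append (G.dartWalk a)).cls⟩ - g ⟨G.src a, p.cls⟩ := by
    rintro ⟨e, _ | _⟩ p
    -- The hypothesis covers only the fixed orientation. For a reversed edge, apply it at the far
    -- end: returning along the edge is a backtrack, so the class is again that of `p`.
    · have h := hg e (p.append (G.dartWalk (e, false))).cls
      have h2 : PathClass.extend (e, true) (p.append (G.dartWalk (e, false))).cls = p.cls := by
        refine (Quot.sound ⟨p.1, [], (e, false), by simp, Or.inl ?_⟩).symm
        simp [Walk.append, dartWalk, Dart.rev]
      rw [h2] at h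
      change -ω e = _
      rw [← h]
      exact neg_sub _ _
    · exact (hg e p.cls).symm
  obtain ⟨q, hq⟩ := q
  induction q generalizing u with
  | nil =>
    obtain rfl : u = v := hq
    have : p.append ⟨[], rfl⟩ = p := Subtype.ext (by simp [Walk.append])
    rw [this, integral_nil, sub_self]
  | cons a q ih =>
    obtain ⟨rfl, hq⟩ := hq
    have h : p.append ⟨a :: q, rfl, hq⟩ = (p.append (G.dartWalk a)).append ⟨q, hq⟩ :=
      Subtype.ext (by simp [Walk.append, dartWalk])
    rw [integral_cons, hdart a p, ih (p.append (G.dartWalk a)) hq, h]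
    ring

/-- Going around a face is an elementary homotopy, so the lifted boundary path closes up and `g` has
no increment along it. -/
theorem isClosedForm_of_lift {o : V} {ω : E → ℝ} {g : G.CoverVertex o → ℝ}
    (hg : ∀ (e : E) (x : G.PathClass o (G.tail e)),
      g ⟨G.head e, x.extend (e, true)⟩ - g ⟨G.tail e, x⟩ = ω e) : G.IsClosedForm ω := fun a => by
  obtain ⟨p⟩ := G.exists_walk o (G.src a)
  rw [integral_eq_of_lift hg p ⟨_, G.isWalk_faceBoundary a⟩]
  have h : p.cls = (p.append ⟨_, G.isWalk_faceBoundary a⟩).cls :=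
    Quot.sound ⟨p.1, [], a, by simp, Or.inr (by simp [Walk.append])⟩
  rw [← h, sub_self]

theorem integral_eq_of_deck {o : V} {ω : E → ℝ} {g : G.CoverVertex o → ℝ}
    (hg : ∀ (e : E) (x : G.PathClass o (G.tail e)),
      g ⟨G.head e, x.extend (e, true)⟩ - g ⟨G.tail e, x⟩ = ω e)
    (γ : G.Walk o o) (t : ℝ) (ht : ∀ x, g (deck γ x) = g x + t) : integral ω γ.1 = t := by
  let p : G.Walk o o := ⟨[], rfl⟩
  have h := integral_eq_of_lift hg p γ
  have h1 := ht ⟨o, p.cls⟩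
  have h2 : deck γ ⟨o, p.cls⟩ = ⟨o, (p.append γ).cls⟩ := by
    have : γ.append p = p.append γ := Subtype.ext (by simp [Walk.append, p])
    rw [← this]; rfl
  rw [h2] at h1
  rw [h, h1]; ring

end CellDecomposition

/-! ### Linear algebra: `det₀` of weighted Gram matrices -/

open Matrix

theorem det₀_ne_zero {n : Type*} [Fintype n] [DecidableEq n] (A : Matrix n n ℝ) : det₀ A ≠ 0 := by
  unfold det₀
  exact Multiset.prod_ne_zero fun h => (Multiset.mem_filter.1 h).2 rfl

/-- If the kernel of a symmetric matrix is spanned by the unit vector `u`, then adding the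
projection to `u` replaces the eigenvalue `0` by `1`. -/
theorem det₀_eq_det_add_vecMulVec {n : Type*} [Fintype n] [DecidableEq n] {A : Matrix n n ℝ}
    (hA : A.IsHermitian) {u : n → ℝ} (hu : u ⬝ᵥ u = 1) (hAu : A *ᵥ u = 0)
    (hker : ∀ v, A *ᵥ v = 0 → ∃ t : ℝ, v = t • u) : det₀ A = (A + vecMulVec u u).det := by
  classical
  let b := hA.eigenvectorBasis
  let lam := hA.eigenvalues
  have hAb : ∀ i, A *ᵥ (b i).ofLp = lam i • (b i).ofLp := hA.mulVec_eigenvectorBasis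
  have hinner : ∀ i j, (b i).ofLp ⬝ᵥ (b j).ofLp = if i = j then 1 else 0 := fun i j => by
    have h := orthonormal_iff_ite.1 b.orthonormal j i
    rw [EuclideanSpace.inner_eq_star_dotProduct] at h
    simpa [eq_comm] using h
  have horth : ∀ i, lam i ≠ 0 → u ⬝ᵥ (b i).ofLp = 0 := fun i hi => by
    have h : lam i * (u ⬝ᵥ (b i).ofLp) = 0 := by
      rw [← smul_eq_mul, ← dotProduct_smul, ← hAb, dotProduct_mulVec, ← mulVec_transpose]
      have : Aᵀ = A := by simpa [IsHermitian] using hA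
      rw [this, hAu, zero_dotProduct]
    exact (mul_eq_zero.1 h).resolve_left hi
  have hzero : ∀ i, lam i = 0 → ∃ t : ℝ, (b i).ofLp = t • u ∧ t * t = 1 := fun i hi => by
    obtain ⟨t, ht⟩ := hker (b i).ofLp (by rw [hAb, hi, zero_smul])
    refine ⟨t, ht, ?_⟩
    have h := hinner i i
    rw [ht] at h
    simpa [hu] using h
  -- An eigenbasis of `A` also diagonalizes the sum: its vectors are either orthogonal to `u`, by
  -- symmetry of `A`, or multiples of `u`.
  have hB : ∀ i, (A + vecMulVec u u) *ᵥ (b i).ofLp =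
      (if lam i = 0 then 1 else lam i) • (b i).ofLp := fun i => by
    rw [add_mulVec, hAb, vecMulVec_mulVec]
    split_ifs with hi
    · obtain ⟨t, ht, -⟩ := hzero i hi
      rw [ht, hi]
      simp [hu]
    · rw [horth i hi]
      simp
  have hdet : (A + vecMulVec u u).det = ∏ i, if lam i = 0 then 1 else lam i := by
    rw [← det_diagonal, ← LinearMap.det_toLin' (A + vecMulVec u u)]
    let b' : Module.Basis n ℝ (n → ℝ) := b.toBasis.map (WithLp.linearEquiv 2 ℝ (n → ℝ))
    have hb' : ∀ i, b' i = (b i).ofLp := fun i => by simp [b']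
    rw [← LinearMap.det_toMatrix b']
    congr 1
    ext i j
    rw [LinearMap.toMatrix_apply, toLin'_apply, hb', hB, ← hb', map_smul, Module.Basis.repr_self,
      Finsupp.smul_apply, smul_eq_mul]
    by_cases hij : i = j
    · subst hij; simp
    · simp [hij]
  have hroots : A.charpoly.roots = Finset.univ.val.map lam := by
    have := hA.roots_charpoly_eq_eigenvalues
    simpa using this
  rw [hdet, det₀, hroots, Multiset.filter_map, ← Finset.filter_val]
  change ∏ i ∈ Finset.univ.filter _, lam i = _
  rw [Finset.prod_filter]
  exact Finset.prod_congr rfl fun i _ => by by_cases h : lam i = 0 <;> simp [h]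

theorem dotProduct_gram_mulVec {E n : Type*} [Fintype E] [DecidableEq E] [Fintype n]
    (c : E → ℝ) (M : Matrix E n ℝ) (v : n → ℝ) :
    v ⬝ᵥ ((Mᵀ * diagonal c * M) *ᵥ v) = ∑ e, c e * (M *ᵥ v) e ^ 2 := by
  rw [← mulVec_mulVec, ← mulVec_mulVec, dotProduct_mulVec, vecMul_transpose]
  simp only [dotProduct, mulVec_diagonal]
  exact Finset.sum_congr rfl fun e _ => by ring

theorem mulVec_eq_zero_of_gram {E n : Type*} [Fintype E] [DecidableEq E] [Fintype n]
    {c : E → ℝ} (hc : ∀ e, 0 < c e) {M : Matrix E n ℝ} {v : n → ℝ}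
    (hv : v ⬝ᵥ ((Mᵀ * diagonal c * M) *ᵥ v) = 0) : M *ᵥ v = 0 := by
  rw [dotProduct_gram_mulVec,
    Finset.sum_eq_zero_iff_of_nonneg fun e _ => mul_nonneg (hc e).le (sq_nonneg _)] at hv
  ext e
  simpa [(hc e).ne'] using hv e (Finset.mem_univ e)

theorem isHermitian_gram {E n : Type*} [Fintype E] [DecidableEq E] [Fintype n]
    (c : E → ℝ) (M : Matrix E n ℝ) : (Mᵀ * diagonal c * M).IsHermitian := by
  simp [IsHermitian, conjTranspose_eq_transpose_of_trivial, Matrix.mul_assoc]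

/-- The quotient of the `det₀` of the augmented and the original weighted Gram matrix is the Gram
determinant of the `c`-orthogonal representatives of the additional columns. -/
theorem exists_det₀_fromCols_eq {E n k : Type*} [Fintype E] [DecidableEq E] [Fintype n]
    [DecidableEq n] [Fintype k] [DecidableEq k] {c : E → ℝ} (hc : ∀ e, 0 < c e)
    (M : Matrix E n ℝ) (N : Matrix E k ℝ) {u : n → ℝ} (hu : u ⬝ᵥ u = 1) (hMu : M *ᵥ u = 0)
    (hM : ∀ v, M *ᵥ v = 0 → ∃ t : ℝ, v = t • u)
    (hN : ∀ v a, M *ᵥ v + N *ᵥ a = 0 → a = 0) :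
    ∃ K : Matrix n k ℝ, Mᵀ * diagonal c * (N - M * K) = 0 ∧
      det₀ ((fromCols M N)ᵀ * diagonal c * fromCols M N) / det₀ (Mᵀ * diagonal c * M) =
        ((N - M * K)ᵀ * diagonal c * (N - M * K)).det := by
  have hker : ∀ v, (Mᵀ * diagonal c * M) *ᵥ v = 0 → ∃ t : ℝ, v = t • u := fun v hv =>
    hM v (mulVec_eq_zero_of_gram hc (by rw [hv, dotProduct_zero]))
  have h1 := det₀_eq_det_add_vecMulVec (isHermitian_gram c M) hu
    (by rw [← mulVec_mulVec, hMu, mulVec_zero]) hker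
  set u' : n ⊕ k → ℝ := Sum.elim u 0 with hu'
  have hM' : fromCols M N *ᵥ u' = 0 := by simp [hu', fromCols_mulVec, hMu]
  have hker' : ∀ v, ((fromCols M N)ᵀ * diagonal c * fromCols M N) *ᵥ v = 0 →
      ∃ t : ℝ, v = t • u' := fun v hv => by
    have h := mulVec_eq_zero_of_gram hc (by rw [hv, dotProduct_zero])
    rw [fromCols_mulVec] at h
    have ha := hN _ _ h
    rw [ha, mulVec_zero, add_zero] at h
    obtain ⟨t, ht⟩ := hM _ h
    refine ⟨t, ?_⟩
    ext (i | i)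
    · simpa [hu'] using congrFun ht i
    · simpa [hu'] using congrFun ha i
  have h2 := det₀_eq_det_add_vecMulVec (isHermitian_gram c (fromCols M N)) (u := u')
    (by simp [hu', dotProduct] at hu ⊢; exact hu) (by rw [← mulVec_mulVec, hM', mulVec_zero]) hker'
  set P := vecMulVec u u with hP
  set Q := Mᵀ * diagonal c * M + P with hQ
  have hblock : (fromCols M N)ᵀ * diagonal c * fromCols M N + vecMulVec u' u' =
      fromBlocks Q (Mᵀ * diagonal c * N) (Nᵀ * diagonal c * M) (Nᵀ * diagonal c * N) := by
    rw [transpose_fromCols, fromRows_mul, fromRows_mul_fromCols]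
    ext (i | i) (j | j) <;> simp [hQ, hP, hu', vecMulVec_apply]
  have hQdet : IsUnit Q.det := by
    rw [← h1]; exact (det₀_ne_zero _).isUnit
  have hMP : M * P = 0 := by rw [hP, mul_vecMulVec, hMu, zero_vecMulVec]
  have hPt : Pᵀ = P := by rw [hP, transpose_vecMulVec]
  have hPM : P * Mᵀ = 0 := by rw [← hPt, ← transpose_mul, hMP, transpose_zero]
  have hPP : P * P = P := by rw [hP, vecMulVec_mul_vecMulVec, hu, one_smul]
  -- Since `P` kills `Mᵀ` on the left and is idempotent, `P * Q⁻¹ = P`. Hence `Mᵀ C M Q⁻¹ = 1 - P`,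
  -- which fixes `Mᵀ C N`; so `K = Q⁻¹ Mᵀ C N` solves the normal equations.
  have hPQ : P * Q = P := by
    rw [hQ, Matrix.mul_add, hPP, Matrix.mul_assoc, ← Matrix.mul_assoc P, hPM]; simp
  have hPQi : P * Q⁻¹ = P := by
    nth_rewrite 1 [← hPQ]
    rw [Matrix.mul_assoc, mul_nonsing_inv _ hQdet, Matrix.mul_one]
  have hharm : Mᵀ * diagonal c * (N - M * (Q⁻¹ * (Mᵀ * diagonal c * N))) = 0 := by
    have e1 : Mᵀ * diagonal c * M = Q - P := by rw [hQ, add_sub_cancel_right]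
    rw [Matrix.mul_sub, ← Matrix.mul_assoc (Mᵀ * diagonal c) M, e1, ← Matrix.mul_assoc (Q - P),
      Matrix.sub_mul, mul_nonsing_inv _ hQdet, hPQi, Matrix.sub_mul, Matrix.one_mul,
      Matrix.mul_assoc Mᵀ, ← Matrix.mul_assoc P, hPM]
    simp
  refine ⟨_, hharm, ?_⟩
  rw [h2, h1, hblock]
  have : Invertible Q := invertibleOfIsUnitDet Q hQdet
  rw [det_fromBlocks₁₁, mul_div_cancel_left₀ _ hQdet.ne_zero, invOf_eq_nonsing_inv]
  congr 1
  -- In the Gram matrix of `N - M * K`, the term with `Kᵀ` vanishes by `hharm`; what is left is the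
  -- Schur complement.
  set K := Q⁻¹ * (Mᵀ * diagonal c * N) with hK
  rw [transpose_sub, Matrix.sub_mul, Matrix.sub_mul, transpose_mul, Matrix.mul_assoc Kᵀ,
    Matrix.mul_assoc Kᵀ, hharm]
  simp only [Matrix.mul_zero, sub_zero, Matrix.mul_sub, hK, Matrix.mul_assoc]

/-- After multiplication by `r` the difference of the two sides is `(rx + q)² + (s - ry)²`, with `s`
the square root. -/
theorem two_mul_sqrt_mul_le {p q r : ℝ} (hr : 0 < r) (hD : 0 ≤ p * r - q ^ 2) (x y : ℝ) :
    2 * √(p * r - q ^ 2) * y ≤ p + 2 * q * x + r * (x ^ 2 + y ^ 2) := by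
  have h := Real.sq_sqrt hD
  set s := √(p * r - q ^ 2)
  refine le_of_mul_le_mul_left ?_ hr
  nlinarith [sq_nonneg (r * x + q), sq_nonneg (s - r * y)]

/-! ### Harmonic representatives -/

namespace CellDecomposition

variable {V E F : Type*} [Fintype V] [DecidableEq V] (G : CellDecomposition V E F)

theorem incidence_mulVec (f : V → ℝ) (e : E) :
    (G.incidence *ᵥ f) e = f (G.head e) - f (G.tail e) := by
  simp [incidence, mulVec, dotProduct, sub_mul, Finset.sum_sub_distrib]

theorem eq_const_of_incidence_mulVec_eq_zero {f : V → ℝ} (h : G.incidence *ᵥ f = 0) (u v : V) :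
    f u = f v := by
  obtain ⟨p, hp⟩ := G.exists_walk u v
  have h1 := G.integral_grad f hp
  have h2 : (fun e => f (G.head e) - f (G.tail e)) = fun _ => 0 := by
    ext e; rw [← G.incidence_mulVec, h]; rfl
  rw [h2, integral_zero] at h1
  linarith

/-- Given closed forms with the dual periods of two generators, there are cohomologous harmonic
forms; their Gram determinant is the quotient of the two `det₀`. -/
theorem exists_harmonic_forms [Fintype E] [DecidableEq E] {o : V} {γ : Fin 2 → G.Walk o o}
    {c : E → ℝ} (hc : ∀ e, 0 < c e) {m : Fin 2 → E → ℝ} (hm : ∀ k, G.IsClosedForm (m k))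
    (hper : ∀ k l, integral (m k) (γ l).1 = if k = l then 1 else 0) :
    ∃ ω : Fin 2 → E → ℝ, (∀ k, G.IsClosedForm (ω k)) ∧
      (∀ k l, integral (ω k) (γ l).1 = if k = l then 1 else 0) ∧
      (∀ k (f : V → ℝ), ∑ e, c e * ω k e * (f (G.head e) - f (G.tail e)) = 0) ∧
      det₀ ((G.augmented m)ᵀ * diagonal c * G.augmented m) /
          det₀ (G.incidenceᵀ * diagonal c * G.incidence) =
        (∑ e, c e * ω 0 e ^ 2) * (∑ e, c e * ω 1 e ^ 2) - (∑ e, c e * ω 0 e * ω 1 e) ^ 2 := by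
  have hcard : (0 : ℝ) < Fintype.card V := by
    have := G.nonempty
    exact_mod_cast Fintype.card_pos
  -- Normalizes the constant vector, which spans the kernel of `d` by connectedness.
  set t : ℝ := (√(Fintype.card V))⁻¹ with ht
  have ht0 : t ≠ 0 := by positivity
  have hconst : ∀ s : ℝ, G.incidence *ᵥ (fun _ => s) = 0 := fun s => by
    ext e; rw [incidence_mulVec]; simp
  obtain ⟨K, hK, hdet⟩ := exists_det₀_fromCols_eq hc G.incidence
    (of fun e k => m k e : Matrix E (Fin 2) ℝ) (u := fun _ => t)
    (by
      simp only [dotProduct, Finset.sum_const, Finset.card_univ, nsmul_eq_mul, ht]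
      rw [← mul_inv, Real.mul_self_sqrt hcard.le, mul_inv_cancel₀ hcard.ne'])
    (hconst t)
    (fun v hv => ⟨v o / t, by
      ext w
      simp [ht0, G.eq_const_of_incidence_mulVec_eq_zero hv w o]⟩)
    -- Integration along `γ l` kills the gradient and, the periods being dual, isolates `a l`.
    (fun v a hva => by
      have h : (fun e => v (G.head e) - v (G.tail e) - (-a 0) * m 0 e - (-a 1) * m 1 e) =
          fun e => 0 := by
        ext e
        have h := congrFun hva e
        simp only [Pi.add_apply, incidence_mulVec, Pi.zero_apply] at h
        simp only [mulVec, dotProduct, of_apply, Fin.sum_univ_two] at h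
        linarith
      have h2 : ∀ l, a l = 0 := fun l => by
        have h3 := congrArg (fun η => integral η (γ l).1) h
        simp only [integral_sub_smul _ (m 1), integral_sub_smul _ (m 0),
          G.integral_grad v (γ l).2, hper] at h3
        rw [integral_zero] at h3
        fin_cases l <;> simpa using h3
      exact funext h2)
  set H : Matrix E (Fin 2) ℝ := (of fun e k => m k e : Matrix E (Fin 2) ℝ) - G.incidence * K
    with hH
  let ω : Fin 2 → E → ℝ := fun k e => H e k
  have hHe : ∀ k, ω k =
      fun e => m k e - 1 * ((fun v => K v k) (G.head e) - (fun v => K v k) (G.tail e)) :=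
    fun k => by
      ext e
      have h : (G.incidence * K) e k = (G.incidence *ᵥ fun v => K v k) e := rfl
      simp only [ω, hH, Matrix.sub_apply, h, incidence_mulVec, one_mul, of_apply]
  refine ⟨ω, fun k => ?_, fun k l => ?_, fun k f => ?_, ?_⟩
  · rw [hHe]
    exact (hm k).sub_smul (G.isClosedForm_grad fun v => K v k) 1
  · rw [hHe, integral_sub_smul, G.integral_grad (fun v => K v k) (γ l).2, hper]
    simp
  · have h : f ⬝ᵥ ((G.incidenceᵀ * diagonal c * H) *ᵥ Pi.single k 1) = 0 := by
      rw [hK, zero_mulVec, dotProduct_zero]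
    rw [← mulVec_mulVec, ← mulVec_mulVec, dotProduct_mulVec, vecMul_transpose] at h
    rw [← h]
    simp only [dotProduct, mulVec_diagonal, incidence_mulVec, mulVec_single_one, col_apply]
    exact Finset.sum_congr rfl fun e _ => by ring
  · have hS : ∀ k l, (Hᵀ * diagonal c * H) k l = ∑ e, c e * H e k * H e l := fun k l => by
      rw [mul_apply]
      simp only [mul_diagonal, transpose_apply]
      exact Finset.sum_congr rfl fun e _ => by ring
    change det₀ ((fromCols _ _)ᵀ * diagonal c * fromCols _ _) / _ = _
    rw [hdet, det_fin_two, hS, hS, hS, hS]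
    have h10 : ∑ e, c e * H e 1 * H e 0 = ∑ e, c e * H e 0 * H e 1 :=
      Finset.sum_congr rfl fun e _ => by ring
    rw [h10]
    simp only [ω, mul_assoc, sq]

end CellDecomposition

/-! ### Energy of closed forms -/

open CellDecomposition

section Energy

variable {V E F : Type*} [Fintype E] {G : CellDecomposition V E F} {o : V}
  {γ : Fin 2 → G.Walk o o} {c : E → ℝ} {ω : Fin 2 → E → ℝ}

theorem sum_mul_sq_harmonic_combination (c : E → ℝ) (ω : Fin 2 → E → ℝ) (a b : ℝ) :
    ∑ e, c e * (a * ω 0 e + b * ω 1 e) ^ 2 = (∑ e, c e * ω 0 e ^ 2) * a ^ 2 +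
      2 * (∑ e, c e * ω 0 e * ω 1 e) * a * b + (∑ e, c e * ω 1 e ^ 2) * b ^ 2 := by
  simp only [Finset.mul_sum, Finset.sum_mul, ← Finset.sum_add_distrib]
  exact Finset.sum_congr rfl fun e _ => by ring

/-- Among the closed forms with given periods the harmonic one has the least energy. -/
theorem sum_mul_sq_ge_of_periods (hγ : G.Generates γ) (hc : ∀ e, 0 < c e)
    (hω : ∀ k, G.IsClosedForm (ω k))
    (hper : ∀ k l, integral (ω k) (γ l).1 = if k = l then 1 else 0)
    (hharm : ∀ k (f : V → ℝ), ∑ e, c e * ω k e * (f (G.head e) - f (G.tail e)) = 0)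
    {η : E → ℝ} (hη : G.IsClosedForm η) :
    ∑ e, c e * (integral η (γ 0).1 * ω 0 e + integral η (γ 1).1 * ω 1 e) ^ 2 ≤
      ∑ e, c e * η e ^ 2 := by
  set a := integral η (γ 0).1 with ha
  set b := integral η (γ 1).1 with hb
  obtain ⟨f, hf⟩ := hγ.exists_grad ((hη.sub_smul (hω 0) a).sub_smul (hω 1) b) fun k => by
    rw [integral_sub_smul _ (ω 1), integral_sub_smul, hper, hper]
    fin_cases k <;> simp [ha, hb]
  have h0 := hharm 0 f
  have h1 := hharm 1 f
  -- Pythagoras: `η` is the harmonic combination plus the gradient of `f`, and the cross terms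
  -- vanish by `h0` and `h1`.
  have h : ∑ e, c e * η e ^ 2 - ∑ e, c e * (a * ω 0 e + b * ω 1 e) ^ 2 =
      2 * a * ∑ e, c e * ω 0 e * (f (G.head e) - f (G.tail e)) +
      2 * b * ∑ e, c e * ω 1 e * (f (G.head e) - f (G.tail e)) +
      ∑ e, c e * (f (G.head e) - f (G.tail e)) ^ 2 := by
    simp only [Finset.mul_sum, ← Finset.sum_add_distrib, ← Finset.sum_sub_distrib, ← hf]
    exact Finset.sum_congr rfl fun e _ => by ring
  rw [h0, h1] at h
  have : 0 ≤ ∑ e, c e * (f (G.head e) - f (G.tail e)) ^ 2 :=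
    Finset.sum_nonneg fun e _ => mul_nonneg (hc e).le (sq_nonneg _)
  linarith

/-- If the sum were zero the combination would vanish on every edge, while its periods are `a` and
`b`. -/
theorem sum_mul_sq_harmonic_pos (hc : ∀ e, 0 < c e)
    (hper : ∀ k l, integral (ω k) (γ l).1 = if k = l then 1 else 0)
    {a b : ℝ} (hab : a ≠ 0 ∨ b ≠ 0) : 0 < ∑ e, c e * (a * ω 0 e + b * ω 1 e) ^ 2 := by
  have hnn : ∀ e ∈ Finset.univ, 0 ≤ c e * (a * ω 0 e + b * ω 1 e) ^ 2 :=
    fun e _ => mul_nonneg (hc e).le (sq_nonneg _)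
  refine lt_of_le_of_ne (Finset.sum_nonneg hnn) fun h => ?_
  have hz := (Finset.sum_eq_zero_iff_of_nonneg hnn).1 h.symm
  have hz' : (fun e => (fun e => (0 : ℝ) - (-a) * ω 0 e) e - (-b) * ω 1 e) = fun _ => 0 := by
    ext e
    have := hz e (Finset.mem_univ e)
    simp only [mul_eq_zero, (hc e).ne', false_or, pow_eq_zero_iff, ne_eq,
      OfNat.ofNat_ne_zero, not_false_eq_true] at this
    linarith
  have hl : ∀ l, a * integral (ω 0) (γ l).1 + b * integral (ω 1) (γ l).1 = 0 := fun l => by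
    have := congrArg (fun η => integral η (γ l).1) hz'
    simp only [integral_sub_smul, integral_zero] at this
    linarith
  have ha := hl 0
  have hb := hl 1
  simp only [hper] at ha hb
  rcases hab with h | h
  · exact h (by simpa using ha)
  · exact h (by simpa using hb)

/-! ### Straight-line maps as pairs of closed forms -/

namespace StraightLineMap

variable {τ : UpperHalfPlane}

theorem energy_eq (c : E → ℝ) (h : StraightLineMap G τ) :
    h.energy c =
      1 / 2 * (∑ e, c e * (h.vec e).re ^ 2 + ∑ e, c e * (h.vec e).im ^ 2) := by
  rw [energy, ← Finset.sum_add_distrib]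
  congr 1
  refine Finset.sum_congr rfl fun e _ => ?_
  rw [edgeLength, Complex.sq_norm, Complex.normSq_apply]
  ring

theorem InHomotopyClass.closed_and_periods {V E F : Type*} {G : CellDecomposition V E F} {o : V}
    {γ : Fin 2 → G.Walk o o} {h : StraightLineMap G τ} (hh : h.InHomotopyClass γ)
    (φ : ℂ →ₗ[ℝ] ℝ) : G.IsClosedForm (fun e => φ (h.vec e)) ∧
      ∀ k, integral (fun e => φ (h.vec e)) (γ k).1 = φ (torusPeriod τ k) := by
  obtain ⟨ht, hlift, hdeck⟩ := hh
  have hg : ∀ (e : E) (x : G.PathClass o (G.tail e)),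
      φ (ht ⟨G.head e, x.extend (e, true)⟩) - φ (ht ⟨G.tail e, x⟩) = φ (h.vec e) := fun e x => by
    rw [← map_sub, hlift.2]
  refine ⟨isClosedForm_of_lift (g := fun x => φ (ht x)) hg, fun k => ?_⟩
  exact integral_eq_of_deck (g := fun x => φ (ht x)) hg (γ k) _ fun x => by rw [hdeck, map_add]

/-- The straight-line map whose edge vectors are the combination of integral closed forms with the
periods of the torus as coefficients. -/
theorem exists_of_closed_forms {V E F : Type*} {G : CellDecomposition V E F} {o : V}
    {γ : Fin 2 → G.Walk o o} {ω : Fin 2 → E → ℝ} (hγ : G.Generates γ)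
    (hω : ∀ k, G.IsClosedForm (ω k))
    (hper : ∀ k l, integral (ω k) (γ l).1 = if k = l then 1 else 0) (τ : UpperHalfPlane) :
    ∃ h : StraightLineMap G τ, h.InHomotopyClass γ ∧
      ∀ e, h.vec e = ω 0 e * torusPeriod τ 0 + ω 1 e * torusPeriod τ 1 := by
  let w : ∀ v, G.Walk o v := fun v => (G.exists_walk o v).some
  let dev : List (Dart E) → ℂ := fun p =>
    integral (ω 0) p * torusPeriod τ 0 + integral (ω 1) p * torusPeriod τ 1
  -- Periods of `ω k` are integers, so changing the path moves the developed position by a lattice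
  -- vector.
  have hdev : ∀ {v : V} (p q : G.Walk o v),
      (dev p.1 : EuclideanTorus τ) = (dev q.1 : EuclideanTorus τ) := fun {v} p q => by
    have hint : ∀ k, ∃ n : ℤ, (n : ℝ) = integral (ω k) p.1 - integral (ω k) q.1 := fun k => by
      refine hγ.integral_sub_mem (hω k) (Int.castAddHom ℝ).range (fun l => ?_) p.2 q.2
      rw [hper]
      exact ⟨if k = l then 1 else 0, by split_ifs <;> simp⟩
    obtain ⟨n0, h0⟩ := hint 0
    obtain ⟨n1, h1⟩ := hint 1
    rw [QuotientAddGroup.eq_iff_sub_mem]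
    have h : dev p.1 - dev q.1 = n0 • torusPeriod τ 0 + n1 • torusPeriod τ 1 := by
      have h0' := congrArg (fun x : ℝ => (x : ℂ)) h0
      have h1' := congrArg (fun x : ℝ => (x : ℂ)) h1
      simp only [Complex.ofReal_sub, Complex.ofReal_intCast] at h0' h1'
      rw [zsmul_eq_mul, zsmul_eq_mul, h0', h1']
      ring
    rw [h]
    exact add_mem (zsmul_mem (AddSubgroup.subset_closure (Set.mem_range_self 0)) _)
      (zsmul_mem (AddSubgroup.subset_closure (Set.mem_range_self 1)) _)
  have hadd : ∀ p q, dev (p ++ q) = dev p + dev q := fun p q => by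
    simp only [dev, integral_append, Complex.ofReal_add]; ring
  have hdart : ∀ e, dev [(e, true)] = ω 0 e * torusPeriod τ 0 + ω 1 e * torusPeriod τ 1 :=
    fun e => by simp [dev, integral, dartValue]
  let h : StraightLineMap G τ :=
    { pos := fun v => (dev (w v).1 : EuclideanTorus τ)
      vec := fun e => ω 0 e * torusPeriod τ 0 + ω 1 e * torusPeriod τ 1
      pos_head := fun e => by
        rw [hdev (w (G.head e)) ((w (G.tail e)).append (G.dartWalk (e, true))), ← hdart,
          ← QuotientAddGroup.mk_add, ← hadd]
        rfl }
  refine ⟨h, ⟨fun x => (hω 0).classIntegral x.2 * torusPeriod τ 0 +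
    (hω 1).classIntegral x.2 * torusPeriod τ 1, ⟨?_, ?_⟩, ?_⟩, fun _ => rfl⟩
  · rintro ⟨v, ⟨p⟩⟩
    exact hdev p (w v)
  · rintro e ⟨p⟩
    change dev (p.1 ++ [(e, true)]) - dev p.1 = _
    rw [hadd, hdart, add_sub_cancel_left]
  · rintro k ⟨v, ⟨p⟩⟩
    change dev ((γ k).1 ++ p.1) = dev p.1 + _
    rw [hadd, add_comm]
    congr 1
    simp only [dev, hper]
    fin_cases k <;> simp

theorem torusPeriod_re_im (τ : UpperHalfPlane) :
    (torusPeriod τ 0).re = 1 / √τ.im ∧ (torusPeriod τ 0).im = 0 ∧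
      (torusPeriod τ 1).re = τ.re / √τ.im ∧ (torusPeriod τ 1).im = τ.im / √τ.im := by
  have h : (1 : ℂ) / (√τ.im : ℂ) = ((1 / √τ.im : ℝ) : ℂ) := by push_cast; rfl
  refine ⟨?_, ?_, ?_, ?_⟩
  · simp only [torusPeriod, cons_val_zero, h, Complex.ofReal_re]
  · simp only [torusPeriod, cons_val_zero, h, Complex.ofReal_im]
  · simp only [torusPeriod, cons_val_one, cons_val_fin_one, Complex.div_ofReal_re]
    rfl
  · simp only [torusPeriod, cons_val_one, cons_val_fin_one, Complex.div_ofReal_im]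
    rfl

/-- The energy of the harmonic map to the torus with parameter `τ`. -/
theorem harmonic_energy_eq (p q r : ℝ) (τ : UpperHalfPlane) :
    1 / 2 * ((p * (torusPeriod τ 0).re ^ 2 +
        2 * q * (torusPeriod τ 0).re * (torusPeriod τ 1).re + r * (torusPeriod τ 1).re ^ 2) +
      (p * (torusPeriod τ 0).im ^ 2 +
        2 * q * (torusPeriod τ 0).im * (torusPeriod τ 1).im + r * (torusPeriod τ 1).im ^ 2)) =
      (p + 2 * q * τ.re + r * (τ.re ^ 2 + τ.im ^ 2)) / (2 * τ.im) := by
  obtain ⟨h1, h2, h3, h4⟩ := torusPeriod_re_im τ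
  rw [h1, h2, h3, h4]
  have hy := τ.im_pos
  have hs := Real.sq_sqrt hy.le
  have hs0 : √τ.im ≠ 0 := (Real.sqrt_pos.2 hy).ne'
  have e1 : (1 / √τ.im) ^ 2 = 1 / τ.im := by rw [div_pow, hs, one_pow]
  have e2 : (τ.re / √τ.im) ^ 2 = τ.re ^ 2 / τ.im := by rw [div_pow, hs]
  have e3 : (τ.im / √τ.im) ^ 2 = τ.im ^ 2 / τ.im := by rw [div_pow, hs]
  have e4 : 2 * q * (1 / √τ.im) * (τ.re / √τ.im) = 2 * q * τ.re / τ.im := by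
    rw [show 2 * q * (1 / √τ.im) * (τ.re / √τ.im) = 2 * q * τ.re / √τ.im ^ 2 by ring, hs]
  rw [e1, e2, e3, e4]
  field_simp
  ring

end StraightLineMap

end Energy

/-! ### Minimization over maps and tori -/

/-- The Dirichlet energy on the space of all pairs of a Euclidean torus of unit area and a
straight-line map to it in the given homotopy class attains its minimum, and the minimum is
`√(det₀ (d̃ᵀ C d̃) / det₀ (dᵀ C d))`. -/
theorem theorem3 {V E F : Type*} [Fintype V] [Fintype E] [Fintype F]
    [DecidableEq V] [DecidableEq E]
    (G : CellDecomposition V E F) (hG : G.IsTorus)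
    (o : V) (γ : Fin 2 → G.Walk o o) (hγ : G.Generates γ)
    (c : E → ℝ) (hc : ∀ e, 0 < c e)
    (m : Fin 2 → E → ℝ) (hm : ∀ k, G.IsClosedForm (m k))
    (hper : ∀ k l, CellDecomposition.integral (m k) (γ l).1 = if k = l then 1 else 0) :
    IsLeast {r : ℝ | ∃ (τ : UpperHalfPlane) (h : StraightLineMap G τ),
        h.InHomotopyClass γ ∧ h.energy c = r}
      (Real.sqrt
        (det₀ ((G.augmented m).transpose * Matrix.diagonal c * G.augmented m) /
          det₀ (G.incidence.transpose * Matrix.diagonal c * G.incidence))) := by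
  obtain ⟨ω, hω, hωper, hharm, hdet⟩ := G.exists_harmonic_forms hc hm hper
  rw [hdet]
  have hform := sum_mul_sq_harmonic_combination c ω
  have hpos : ∀ {a b : ℝ}, a ≠ 0 ∨ b ≠ 0 → _ := fun {a b} hab =>
    (sum_mul_sq_harmonic_pos hc hωper hab).trans_eq (hform a b)
  set p := ∑ e, c e * ω 0 e ^ 2
  set q := ∑ e, c e * ω 0 e * ω 1 e
  set r := ∑ e, c e * ω 1 e ^ 2
  have hr : 0 < r := by simpa using hpos (a := 0) (b := 1) (by simp)
  have hD : 0 < p * r - q ^ 2 := by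
    -- The quadratic form takes the value `r * (p * r - q ^ 2)` at `(r, -q)`.
    have h := hpos (a := r) (b := -q) (Or.inl hr.ne')
    refine pos_of_mul_pos_right (a := r) ?_ hr.le
    linarith
  constructor
  -- Both squares behind `two_mul_sqrt_mul_le` vanish at this point.
  · let τ : UpperHalfPlane := ⟨⟨-q / r, √(p * r - q ^ 2) / r⟩, div_pos (Real.sqrt_pos.2 hD) hr⟩
    have hre : τ.re = -q / r := rfl
    have him : τ.im = √(p * r - q ^ 2) / r := rfl
    obtain ⟨h, hh, hvec⟩ := StraightLineMap.exists_of_closed_forms hγ hω hωper τ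
    refine ⟨τ, h, hh, ?_⟩
    have h1 : ∀ e, (h.vec e).re = (torusPeriod τ 0).re * ω 0 e + (torusPeriod τ 1).re * ω 1 e :=
      fun e => by rw [hvec]; simp [mul_comm]
    have h2 : ∀ e, (h.vec e).im = (torusPeriod τ 0).im * ω 0 e + (torusPeriod τ 1).im * ω 1 e :=
      fun e => by rw [hvec]; simp [mul_comm]
    rw [StraightLineMap.energy_eq]
    simp only [h1, h2]
    rw [hform, hform, StraightLineMap.harmonic_energy_eq, hre, him]
    have hs := Real.sq_sqrt hD.le
    have hs0 := (Real.sqrt_pos.2 hD).ne'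
    set s := √(p * r - q ^ 2)
    rw [div_eq_iff (by positivity)]
    field_simp
    linear_combination (-1) * hs
  · rintro _ ⟨τ, h, hh, rfl⟩
    obtain ⟨hre, hreper⟩ := hh.closed_and_periods Complex.reLm
    obtain ⟨him, himper⟩ := hh.closed_and_periods Complex.imLm
    have h1 := sum_mul_sq_ge_of_periods hγ hc hω hωper hharm hre
    have h2 := sum_mul_sq_ge_of_periods hγ hc hω hωper hharm him
    rw [hreper, hreper, hform] at h1
    rw [himper, himper, hform] at h2
    simp only [Complex.reLm_coe, Complex.imLm_coe] at h1 h2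
    have h3 := StraightLineMap.harmonic_energy_eq p q r τ
    have h4 : √(p * r - q ^ 2) ≤
        (p + 2 * q * τ.re + r * (τ.re ^ 2 + τ.im ^ 2)) / (2 * τ.im) := by
      rw [le_div_iff₀ (by have := τ.im_pos; positivity)]
      have := two_mul_sqrt_mul_le hr hD.le τ.re τ.im
      linarith
    rw [StraightLineMap.energy_eq]
    linarith
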